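/- Let $n \ge 1$ and let $M_n$ be the algebra of complex $n\times n$ matrices. A linear map $\phi\colon M_n\to M_n$ is positive if it maps positive semidefinite matrices to positive semidefinite matrices, and completely positive if $\iota\otimes\phi$ is positive on $M_n\otimes M_n$, where $\iota$ is the identity map of $M_n$; let $P$ be the cone of all positive maps. For $v\in M_n$ put $\mathrm{Ad}\,v(a)=v^*av$. A mapping cone is a closed convex cone $J\subset P$ (containing $0$) such that $\alpha\circ\phi\circ\beta\in J$ for all $\phi\in J$ and all completely positive $\alpha,\beta$, and such that $\phi^*,\phi^t\in J$ for all $\phi\in J$, where $\mathrm{Tr}(\phi(a)b)=\mathrm{Tr}(a\phi^*(b))$ and $\phi^t(a)=\phi(a^t)^t$ for all $a,b\in M_n$, with $t$ the transpose. It is invariant if $\alpha\circ\phi\circ\beta\in J$ for all $\phi\in J$ and all $\alpha,\beta\in P$. Let $C_\phi=\sum_{i,j}e_{ij}\otimes\phi(e_{ij})$ be the Choi matrix of $\phi$, where $(e_{ij})$ are the standard matrix units, and let $J^o=\{\phi\in P:\mathrm{Tr}(C_\phi C_\psi)\ge 0 \text{ for all } \psi\in J\}$ be the dual cone of $J$.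 Let $D_2$ be the smallest invariant mapping cone that contains $\mathrm{Ad}\,f$ for every (orthogonal) projection $f\in M_n$ of rank $2$. If $e\in M_n$ is a nonzero (orthogonal) projection with $\operatorname{rank}(e)\le 2$ and $\mathrm{Ad}\,e\in D_2^o$, then $\operatorname{rank}(e)=1$. -/

import Mathlib

open Matrix
open scoped ComplexOrder Kronecker Topology

namespace MappingCone

/-- `Mat n` is the algebra of complex `n × n` matrices. -/
abbrev Mat (n : ℕ) : Type := Matrix (Fin n) (Fin n) ℂ

/-- Linear maps of the `n × n` matrices into themselves. -/
abbrev MatMap (n : ℕ) : Type := Mat n →ₗ[ℂ] Mat n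

/-- `φ` is positive: it maps positive matrices to positive matrices. -/
def IsPositive {n : ℕ} (φ : MatMap n) : Prop :=
  ∀ a : Mat n, a.PosSemidef → (φ a).PosSemidef

/-- The map `ι ⊗ φ` on `M_n ⊗ M_n`, whose elements are seen as `n × n` block matrices with
blocks in `M_n`: `φ` is applied to every block. -/
def amplify {n : ℕ} (φ : MatMap n) (x : Matrix (Fin n × Fin n) (Fin n × Fin n) ℂ) :
    Matrix (Fin n × Fin n) (Fin n × Fin n) ℂ :=
  Matrix.comp (Fin n) (Fin n) (Fin n) (Fin n) ℂ
    (((Matrix.comp (Fin n) (Fin n) (Fin n) (Fin n) ℂ).symm x).map φ)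

/-- `φ` is completely positive: `ι ⊗ φ` is positive, with `ι` the identity of `M_n`. -/
def IsCompletelyPositive {n : ℕ} (φ : MatMap n) : Prop :=
  ∀ x : Matrix (Fin n × Fin n) (Fin n × Fin n) ℂ, x.PosSemidef → (amplify φ x).PosSemidef

/-- The Choi matrix `∑ e_ij ⊗ φ(e_ij)`. -/
noncomputable def choi {n : ℕ} (φ : MatMap n) : Matrix (Fin n × Fin n) (Fin n × Fin n) ℂ :=
  ∑ i : Fin n, ∑ j : Fin n, Matrix.single i j (1 : ℂ) ⊗ₖ φ (Matrix.single i j (1 : ℂ))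

/-- `Ad v (a) = v* a v`. -/
def Ad {n : ℕ} (v : Mat n) : MatMap n where
  toFun a := vᴴ * a * v
  map_add' a b := by rw [Matrix.mul_add, Matrix.add_mul]
  map_smul' c a := by simp

/-- The adjoint `φ*` for the trace form, see `trace_map_mul`. -/
noncomputable def traceAdjoint {n : ℕ} (φ : MatMap n) : MatMap n where
  toFun b := Matrix.of fun i j => (φ (Matrix.single j i (1 : ℂ)) * b).trace
  map_add' a b := by
    ext i j
    simp [Matrix.mul_add]
  map_smul' c a := by
    ext i j
    simp

/-- The defining property `Tr(φ(a) b) = Tr(a φ*(b))` of the adjoint. -/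
theorem trace_map_mul {n : ℕ} (φ : MatMap n) (a b : Mat n) :
    (φ a * b).trace = (a * traceAdjoint φ b).trace := by
  conv_lhs => rw [Matrix.matrix_eq_sum_single a]
  have h : ∀ i j, φ (Matrix.single i j (a i j)) = a i j • φ (Matrix.single i j (1 : ℂ)) := by
    intro i j
    rw [← map_smul, Matrix.smul_single, smul_eq_mul, mul_one]
  simp only [map_sum, h, Finset.sum_mul, Matrix.smul_mul, Matrix.trace_sum, Matrix.trace_smul]
  simp [Matrix.trace, Matrix.mul_apply, traceAdjoint]

/-- The map `φ^t (a) = φ(a^t)^t`. -/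
def transposeConj {n : ℕ} (φ : MatMap n) : MatMap n where
  toFun a := (φ aᵀ)ᵀ
  map_add' a b := by simp
  map_smul' c a := by simp

/-- The topology of pointwise convergence on the linear maps of `M_n` into itself. As this space
has finite dimension, it is the topology of any norm. -/
noncomputable abbrev mapTopology (n : ℕ) : TopologicalSpace (MatMap n) :=
  TopologicalSpace.induced (fun (φ : MatMap n) (a : Mat n) => φ a) inferInstance

/-- A (symmetric) mapping cone: a closed convex cone of positive maps, closed under composition
with completely positive maps on both sides and under `φ ↦ φ*` and `φ ↦ φ^t`. (A `PointedCone`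
is a convex cone that contains `0`.) -/
structure IsMappingCone {n : ℕ} (J : PointedCone ℝ (MatMap n)) : Prop where
  isPositive : ∀ φ ∈ J, IsPositive φ
  isClosed : IsClosed[mapTopology n] (J : Set (MatMap n))
  comp_mem : ∀ φ ∈ J, ∀ α β : MatMap n, IsCompletelyPositive α → IsCompletelyPositive β →
    α ∘ₗ φ ∘ₗ β ∈ J
  adjoint_mem : ∀ φ ∈ J, traceAdjoint φ ∈ J
  transpose_mem : ∀ φ ∈ J, transposeConj φ ∈ J

/-- An invariant mapping cone: closed under composition with all positive maps. -/
structure IsInvariantMappingCone {n : ℕ} (J : PointedCone ℝ (MatMap n)) : Prop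
    extends IsMappingCone J where
  comp_mem_of_isPositive : ∀ φ ∈ J, ∀ α β : MatMap n, IsPositive α → IsPositive β →
    α ∘ₗ φ ∘ₗ β ∈ J

/-- The invariant mapping cone generated by a set `S` of maps: the intersection of all the
invariant mapping cones that contain `S`. -/
noncomputable def generatedCone {n : ℕ} (S : Set (MatMap n)) : PointedCone ℝ (MatMap n) :=
  sInf {J | IsInvariantMappingCone J ∧ S ⊆ (J : Set (MatMap n))}

/-- `D₂`: the invariant mapping cone generated by the maps `Ad f`, `f` a projection of rank 2. -/
noncomputable def D₂ (n : ℕ) : PointedCone ℝ (MatMap n) :=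
  generatedCone {φ | ∃ f : Mat n, IsStarProjection f ∧ f.rank = 2 ∧ φ = Ad f}

/-- The dual cone `J° = {φ ∈ P : Tr(C_φ C_ψ) ≥ 0 for all ψ ∈ J}`. -/
def dualCone {n : ℕ} (J : PointedCone ℝ (MatMap n)) : Set (MatMap n) :=
  {φ | IsPositive φ ∧ ∀ ψ ∈ J, 0 ≤ (choi φ * choi ψ).trace}

end MappingCone

namespace MappingCone

/-! Only rank 2 has to be excluded, and a positive map that is not completely positive excludes it.
The reduction map `a ↦ Tr(eae) e - eae` is positive and unchanged by precomposition with `Ad e`, so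
when `e` has rank 2 invariance places it in `D₂` (`reduction_mem_D₂`). Its Choi pairing with `Ad e`
is `Tr e - (Tr e)² = 2 - 4 < 0` (`trace_choi_Ad_mul_choi_reduction`), so `Ad e` is not in the dual
cone. -/

/-- The Choi pairing as a sum over the matrix units. -/
theorem trace_choi_mul_choi {n : ℕ} (φ ψ : MatMap n) :
    (choi φ * choi ψ).trace =
      ∑ i, ∑ j, (φ (single i j (1 : ℂ)) * ψ (single j i (1 : ℂ))).trace := by
  have h : ∀ i j k l : Fin n, (single i j (1 : ℂ) * single k l (1 : ℂ)).trace =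
      if j = k then (if i = l then 1 else 0) else 0 := by
    intro i j k l
    by_cases hjk : j = k
    · subst hjk
      by_cases hil : i = l
      · subst hil; simp
      · simp [hil, Matrix.trace_single_eq_of_ne]
    · simp [hjk]
  simp only [choi, Finset.sum_mul, Finset.mul_sum, trace_sum, ← mul_kronecker_mul,
    trace_kronecker, h, ite_mul, one_mul, zero_mul]
  rw [Finset.sum_comm]
  refine Finset.sum_congr rfl fun i _ => Finset.sum_congr rfl fun j _ => ?_
  simp

/-- This is a Kraus form, with antisymmetric operators, for the reduction map composed with the
transpose. Since `aᵀ` is positive whenever `a` is, it makes the positivity of `Tr(a) 1 - a` visible.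
The factor 2 arises because each pair `i ≠ j` is counted twice. -/
theorem sum_conj_antisymm_single {n : ℕ} (a : Mat n) :
    ∑ i : Fin n, ∑ j : Fin n, (single i j (1 : ℂ) - single j i (1 : ℂ))ᴴ * aᵀ *
      (single i j (1 : ℂ) - single j i (1 : ℂ)) = (2 : ℂ) • (a.trace • (1 : Mat n) - a) := by
  have h : ∀ i j k l : Fin n, single i j (1 : ℂ) * aᵀ * single k l (1 : ℂ) =
      a k j • single i l (1 : ℂ) := by
    intro i j k l
    simp
  have h' : ∀ i j : Fin n, (single i j (1 : ℂ) - single j i (1 : ℂ))ᴴ * aᵀ *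
      (single i j (1 : ℂ) - single j i (1 : ℂ)) =
      a i i • single j j (1 : ℂ) - a i j • single i j (1 : ℂ) -
        (a j i • single j i (1 : ℂ) - a j j • single i i (1 : ℂ)) := by
    intro i j
    simp only [conjTranspose_sub, conjTranspose_single, star_one, sub_mul, mul_sub, h]
  have h1 : ∑ j : Fin n, single j j (1 : ℂ) = (1 : Mat n) := by
    rw [← diagonal_one, ← sum_single_eq_diagonal]
  have h2 : ∑ i : Fin n, ∑ j : Fin n, a i j • single i j (1 : ℂ) = a := by
    conv_rhs => rw [matrix_eq_sum_single a]
    simp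
  have h3 : ∑ i : Fin n, ∑ j : Fin n, a j i • single j i (1 : ℂ) = a := by
    rw [Finset.sum_comm, h2]
  simp only [h', Finset.sum_sub_distrib, h2, h3, ← Finset.smul_sum, h1, ← Finset.sum_smul]
  simp only [two_smul]
  simp only [trace, diag_apply]
  abel

theorem posSemidef_trace_smul_one_sub {n : ℕ} {a : Mat n} (ha : a.PosSemidef) :
    (a.trace • (1 : Mat n) - a).PosSemidef := by
  have h : ((2 : ℂ) • (a.trace • (1 : Mat n) - a)).PosSemidef := by
    rw [← sum_conj_antisymm_single]
    exact posSemidef_sum _ fun i _ => posSemidef_sum _ fun j _ =>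
      ha.transpose.conjTranspose_mul_mul_same _
  have h' := h.smul (a := (2⁻¹ : ℂ)) (by positivity)
  rwa [smul_smul, inv_mul_cancel₀ two_ne_zero, one_smul] at h'

/-- The reduction map `a ↦ Tr(eae) e - eae` of the corner cut out by `e`. -/
noncomputable def reduction {n : ℕ} (e : Mat n) : MatMap n where
  toFun a := (e * a * e).trace • e - e * a * e
  map_add' a b := by
    rw [Matrix.mul_add, Matrix.add_mul, trace_add, add_smul]; abel
  map_smul' c a := by simp [smul_sub, mul_smul]

theorem reduction_apply {n : ℕ} (e a : Mat n) :
    reduction e a = (e * a * e).trace • e - e * a * e := rfl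

theorem isPositive_reduction {n : ℕ} {e : Mat n} (he : IsStarProjection e) :
    IsPositive (reduction e) := by
  intro a ha
  have hs : eᴴ = e := he.isSelfAdjoint
  have hi : e * e = e := he.isIdempotentElem
  -- The case of the full algebra, applied to `eae` and then compressed by `e`.
  have h := (posSemidef_trace_smul_one_sub (ha.conjTranspose_mul_mul_same e)).conjTranspose_mul_mul_same e
  rw [hs] at h
  convert h using 1
  rw [reduction_apply, mul_sub, sub_mul, mul_smul_comm, smul_mul_assoc, mul_one, hi]
  congr 1
  simp only [← mul_assoc, hi]
  simp only [mul_assoc, hi]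

theorem isPositive_id {n : ℕ} : IsPositive (LinearMap.id : MatMap n) := fun _ h => h

theorem reduction_comp_Ad {n : ℕ} {e : Mat n} (he : IsStarProjection e) :
    reduction e ∘ₗ Ad e = reduction e := by
  have hs : eᴴ = e := he.isSelfAdjoint
  have hi : e * e = e := he.isIdempotentElem
  ext1 a
  have h : e * (Ad e a) * e = e * a * e := by
    change e * (eᴴ * a * e) * e = _
    rw [hs]
    simp only [← mul_assoc, hi]
    simp only [mul_assoc, hi]
  simp only [LinearMap.comp_apply, reduction_apply, h]

/-- Invariance is essential here: for `e` of rank 2 the reduction map is not completely positive. -/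
theorem reduction_mem_D₂ {n : ℕ} {e : Mat n} (he : IsStarProjection e) (hr : e.rank = 2) :
    reduction e ∈ D₂ n := by
  rw [D₂, generatedCone, Submodule.mem_sInf]
  rintro J ⟨hJ, hS⟩
  have h := hJ.comp_mem_of_isPositive _ (hS ⟨e, he, hr, rfl⟩) _ _ (isPositive_reduction he)
    isPositive_id
  rwa [LinearMap.comp_id, reduction_comp_Ad he] at h

theorem trace_eq_rank {n : ℕ} {e : Mat n} (he : IsIdempotentElem e) : e.trace = e.rank := by
  have hp : IsIdempotentElem (toLin' e) := by
    rw [IsIdempotentElem, Module.End.mul_eq_comp, ← toLin'_mul, he]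
  have h := LinearMap.IsProj.trace (LinearMap.IsIdempotentElem.isProj_range _ hp)
  rwa [trace_toLin'_eq] at h

/-- Summed over `i, j`, the term `Tr(eae) e` contributes `Tr(e²) = Tr e`, and the term `eae`
contributes `(Tr e)²`. -/
theorem trace_choi_Ad_mul_choi_reduction {n : ℕ} {e : Mat n} (he : IsStarProjection e) :
    (choi (Ad e) * choi (reduction e)).trace = e.trace - e.trace ^ 2 := by
  have hs : eᴴ = e := he.isSelfAdjoint
  have hi : e * e = e := he.isIdempotentElem
  have h1 : ∀ i j : Fin n, (Ad e (single i j (1 : ℂ)) * reduction e (single j i (1 : ℂ))).trace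
      = e j i * e i j - e i i * e j j := by
    intro i j
    have ht : ∀ (b : Mat n) (k l : Fin n), (single k l (1 : ℂ) * b).trace = b l k := by
      intro b k l
      simp [Matrix.trace_single_mul]
    have hc : ∀ b : Mat n, (e * b * e).trace = (b * e).trace := by
      intro b
      rw [trace_mul_comm, ← mul_assoc, hi, trace_mul_comm]
    change (eᴴ * single i j (1 : ℂ) * e * _).trace = _
    rw [hs, reduction_apply, mul_sub, trace_sub, mul_smul_comm, trace_smul, mul_assoc _ e e, hi,
      hc, hc, ht, ht]
    have : e * single i j (1 : ℂ) * e * (e * single j i (1 : ℂ) * e) =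
      e * (single i j (1 : ℂ) * (e * single j i (1 : ℂ))) * e := by
      rw [show e * single i j (1 : ℂ) * e * (e * single j i (1 : ℂ) * e) =
        e * single i j (1 : ℂ) * (e * e) * single j i (1 : ℂ) * e by simp only [mul_assoc], hi]
      simp only [mul_assoc]
    -- The inner product collapses by `e_ij e e_ji = e_jj-entry of e` times the matrix unit at `(i,
    -- i)`.
    rw [this, hc, ← mul_assoc (single i j (1 : ℂ)) e, single_mul_mul_single, one_mul, mul_one,
      show single i i (e j j) = e j j • single i i (1 : ℂ) by simp, smul_mul_assoc, trace_smul, ht,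
      smul_eq_mul, smul_eq_mul]
    ring
  rw [trace_choi_mul_choi]
  simp only [h1, Finset.sum_sub_distrib]
  congr 1
  · conv_rhs => rw [← hi]
    rw [Finset.sum_comm]
    simp [Matrix.trace, Matrix.mul_apply]
  · simp [Matrix.trace, sq, Finset.sum_mul_sum]

end MappingCone

/-- If `e` is a nonzero projection of rank at most 2 with `Ad e ∈ D₂°`, then `e` has rank 1. -/
theorem corollary7 (n : ℕ) (e : Matrix (Fin n) (Fin n) ℂ) (he : IsStarProjection e)
    (he0 : e ≠ 0) (hrank : e.rank ≤ 2)
    (hAd : MappingCone.Ad e ∈ MappingCone.dualCone (MappingCone.D₂ n)) :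
    e.rank = 1 := by
  have h0 : e.rank ≠ 0 := by 
    intro h
    apply he0
    have h' := Submodule.finrank_eq_zero.1 h
    exact toLin'.injective (by rw [map_zero]; exact LinearMap.range_eq_bot.1 h')
  by_contra h1
  have h2 : e.rank = 2 := by omega
  have h := hAd.2 _ (MappingCone.reduction_mem_D₂ he h2)
  rw [MappingCone.trace_choi_Ad_mul_choi_reduction he,
    MappingCone.trace_eq_rank he.isIdempotentElem, h2] at h
  norm_num [Complex.le_def] at h
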